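/- For $\theta\in\mathbb R^n$ write $\mathbb E_\theta$ for expectation when $X\sim N(\theta,I_n)$, and let $\|\cdot\|$ be the Euclidean norm. An estimator is a measurable map $\delta:\mathbb R^n\to\mathbb R^n$; its risk at $\theta$ is $\mathbb E_\theta\|\delta(X)-\theta\|^2\in[0,\infty]$. For $C>0$ and $\Theta\subseteq\mathbb R^n$, an estimator $\delta$ is called $C$-admissible over $\Theta$ if for every estimator $\tilde\delta$ there is $\theta\in\Theta$ with $$C\,\mathbb E_\theta\|\delta(X)-\theta\|^2\le \mathbb E_\theta\|\tilde\delta(X)-\theta\|^2 .$$ Theorem. There is a universal constant $C$ with $6.05\times10^{-6}\le C\le 1$ (independent of $n$, $\Theta$ and $f$) such that the following holds. Let $n\ge1$, let $\Theta\subseteq\mathbb R^n$ be closed and convex, and let $f:\Theta\to\mathbb R$ be convex and bounded below. Suppose that for Lebesgue-almost every $x\in\mathbb R^n$ the function $\alpha\mapsto\frac12\|x-\alpha\|^2+f(\alpha)$ attains its minimum over $\Theta$ (which is automatic, for every $x$, if $\Theta\neq\emptyset$ and $f$ is lower semicontinuous), so that the (necessarily unique) minimizer $$\widehat\theta(x;\Theta,f)=\operatorname*{argmin}_{\alpha\in\Theta}\Big(\tfrac12\|x-\alpha\|^2+f(\alpha)\Big)$$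 is defined for almost every $x$. Then the penalized least squares estimator $\widehat\theta(X;\Theta,f)$ is $C$-admissible over $\Theta$. -/

import Mathlib

open MeasureTheory ProbabilityTheory

namespace GaussianSequence

/-- The law `N(θ, Iₙ)` of the observation `X` in the Gaussian sequence model. -/
noncomputable def law {n : ℕ} (θ : EuclideanSpace ℝ (Fin n)) :
    Measure (EuclideanSpace ℝ (Fin n)) :=
  multivariateGaussian θ (1 : Matrix (Fin n) (Fin n) ℝ)

/-- The quadratic risk `E_θ ‖δ(X) - θ‖²` of an estimator `δ`, as an extended nonnegative real
(so an estimator of infinite risk has risk `∞`). -/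
noncomputable def risk {n : ℕ} (δ : EuclideanSpace ℝ (Fin n) → EuclideanSpace ℝ (Fin n))
    (θ : EuclideanSpace ℝ (Fin n)) : ENNReal :=
  ∫⁻ x, ENNReal.ofReal (‖δ x - θ‖ ^ 2) ∂(law θ)

/-- `δ` is `C`-admissible over `Θ`: for every estimator `δ'` there is a point `θ ∈ Θ` at which
`C` times the risk of `δ` is at most the risk of `δ'`. -/
def IsCAdmissible {n : ℕ} (C : ℝ) (Θ : Set (EuclideanSpace ℝ (Fin n)))
    (δ : EuclideanSpace ℝ (Fin n) → EuclideanSpace ℝ (Fin n)) : Prop :=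
  ∀ δ' : EuclideanSpace ℝ (Fin n) → EuclideanSpace ℝ (Fin n), Measurable δ' →
    ∃ θ ∈ Θ, ENNReal.ofReal C * risk δ θ ≤ risk δ' θ

/-- `δ` is the penalized least squares estimator with constraint set `Θ` and penalty `f`:
for almost every observation `x`, the point `δ x` minimizes `½‖x - α‖² + f α` over `α ∈ Θ`.
(For convex `f` the minimizer is unique when it exists.) -/
def IsPenalizedLSE {n : ℕ} (Θ : Set (EuclideanSpace ℝ (Fin n)))
    (f : EuclideanSpace ℝ (Fin n) → ℝ)
    (δ : EuclideanSpace ℝ (Fin n) → EuclideanSpace ℝ (Fin n)) : Prop :=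
  ∀ᵐ x ∂(volume : Measure (EuclideanSpace ℝ (Fin n))),
    δ x ∈ Θ ∧ IsMinOn (fun α => (1 / 2 : ℝ) * ‖x - α‖ ^ 2 + f α) Θ (δ x)

end GaussianSequence

/-!
The estimator agrees almost everywhere with a nonexpansive gradient `P` of a convex function `u`,
and `u x ≤ ½‖x‖² + M`. Let `Z`, `W` be independent standard Gaussian vectors and let `θ`
nearly maximize `E u(x + Z) - ½‖x‖²` over `x`; since averaging `P (x + Z)` does not decrease this
functional, `θ` may be taken in the closure of `Θ`. Draw the parameter as
`θ + s (P (θ + Z) - θ)` with `0 < s < 1`, which stays in that closure by convexity.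

To bound the Bayes risk from below, let `d` be the estimate of `P (θ + Z)` induced by a competitor.
Near-maximality of `θ` gives a lower bound for `u (d + Z) - E u(d + Z)` in terms of
`‖P (θ + Z) - θ‖²` and `‖d - P (θ + Z)‖²`. For fixed `d`, the exponential moments of this
fluctuation are controlled by Maurey's property (τ) of the Gaussian measure, which follows from
the Prékopa–Leindler inequality. The dependence of `d` on the observation is removed by a
Cameron–Martin change of measure of the noise `W`, at the cost of `½ s² ‖P (θ + Z) - θ‖²`. Thus
the squared error of `d` has mean at least a constant multiple of the risk of `P` at `θ`, while by
nonexpansiveness the mean risk of `P` under the prior is at most a constant multiple of it.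
-/

namespace GaussianSequence

open Filter
open scoped ENNReal NNReal RealInnerProductSpace Pointwise Topology

section PrekopaLeindler

lemma volume_add_le_of_isCompact {K L : Set ℝ} (hK : IsCompact K) (hL : IsCompact L)
    (hK₀ : K.Nonempty) (hL₀ : L.Nonempty) :
    volume K + volume L ≤ volume (K + L) := by
  obtain ⟨k, hkK, hk⟩ := hK.exists_isGreatest hK₀
  obtain ⟨l, hlL, hl⟩ := hL.exists_isLeast hL₀
  -- The translates `K + l` and `k + L` lie in `K + L` and meet only at `k + l`.
  have hdisj : AEDisjoint volume ((· + l) '' K) ((k + ·) '' L) := by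
    refine measure_mono_null (t := {k + l}) ?_ (by simp)
    rintro _ ⟨⟨x, hx, rfl⟩, y, hy, hxy⟩
    have hxk := hk hx
    have hly := hl hy
    simp only [Set.mem_singleton_iff] at hxy ⊢
    linarith
  have hL' : NullMeasurableSet ((k + ·) '' L) :=
    (hL.image (continuous_const_add k)).measurableSet.nullMeasurableSet
  calc volume K + volume L = volume ((· + l) '' K) + volume ((k + ·) '' L) := by
        rw [Set.image_add_right, Set.image_add_left, measure_preimage_add_right,
          measure_preimage_add]
    _ = volume ((· + l) '' K ∪ (k + ·) '' L) := (measure_union₀ hL' hdisj).symm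
    _ ≤ volume (K + L) := by
        gcongr
        rintro _ (⟨x, hx, rfl⟩ | ⟨y, hy, rfl⟩)
        exacts [Set.add_mem_add hx hlL, Set.add_mem_add hkK hy]

lemma volume_add_le {A B : Set ℝ} (hA : MeasurableSet A) (hB : MeasurableSet B)
    (hA₀ : A.Nonempty) (hB₀ : B.Nonempty) : volume A + volume B ≤ volume (A + B) := by
  obtain ⟨a, ha⟩ := hA₀
  obtain ⟨b, hb⟩ := hB₀
  have hsup {C : Set ℝ} (hC : MeasurableSet C) :
      volume C = ⨆ K ∈ {K | K ⊆ C ∧ IsCompact K}, volume K := by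
    simp only [hC.measure_eq_iSup_isCompact, Set.mem_ofPred_eq, iSup_and]
  rw [hsup hA, hsup hB]
  refine ENNReal.biSup_add_biSup_le ⟨∅, by simp⟩ ⟨∅, by simp⟩ ?_
  rintro K ⟨hKA, hK⟩ L ⟨hLB, hL⟩
  calc volume K + volume L ≤ volume (insert a K) + volume (insert b L) := by
        gcongr <;> exact Set.subset_insert _ _
    _ ≤ volume (insert a K + insert b L) :=
        volume_add_le_of_isCompact (hK.insert a) (hL.insert b)
          (Set.insert_nonempty _ _) (Set.insert_nonempty _ _)
    _ ≤ volume (A + B) := by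
        gcongr <;> exact Set.insert_subset ‹_› ‹_›

lemma lintegral_add_lintegral_le_two_mul {f g h : ℝ → ℝ≥0} (hf : Measurable f)
    (hg : Measurable g) (hh : Measurable h)
    (hsup : ⨆ x, (f x : ℝ≥0∞) = ⨆ y, (g y : ℝ≥0∞))
    (hfg : ∀ x y, f x * g y ≤ h ((x + y) / 2) ^ 2) :
    (∫⁻ x, f x) + ∫⁻ y, g y ≤ 2 * ∫⁻ x, h x := by
  have layercake {k : ℝ → ℝ≥0} (hk : Measurable k) :
      ∫⁻ x, k x = ∫⁻ t in Set.Ioi (0 : ℝ), volume {x | t < k x} := by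
    simpa using lintegral_eq_lintegral_meas_lt volume (ae_of_all _ fun x => (k x).2)
      hk.coe_nnreal_real.aemeasurable
  have hexists (t : ℝ) (ht : 0 < t) : (∃ x, t < f x) ↔ ∃ y, t < g y := by
    have := congrArg (ENNReal.ofReal t < ·) hsup
    simpa [lt_iSup_iff, ENNReal.ofReal_lt_coe_iff ht.le] using this
  have hanti : Antitone fun t : ℝ => volume {x | t < f x} :=
    fun s t hst => measure_mono fun x hx => hst.trans_lt hx
  rw [layercake hf, layercake hg, layercake hh, ← lintegral_const_mul' _ _ (by simp),
    ← lintegral_add_left hanti.measurable]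
  refine setLIntegral_mono' measurableSet_Ioi fun t (ht : 0 < t) => ?_
  by_cases hne : ∃ x, t < f x
  · calc volume {x | t < f x} + volume {y | t < g y}
        ≤ volume ({x | t < f x} + {y | t < g y}) :=
          volume_add_le (measurableSet_lt measurable_const hf.coe_nnreal_real)
            (measurableSet_lt measurable_const hg.coe_nnreal_real) hne ((hexists t ht).1 hne)
      _ ≤ volume ((2⁻¹ * ·) ⁻¹' {z : ℝ | t < h z}) := by
          gcongr
          rintro _ ⟨x, (hx : t < f x), y, (hy : t < g y), rfl⟩
          have hxy : t ^ 2 < h ((x + y) / 2) ^ 2 := by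
            rw [sq]
            exact (mul_lt_mul'' hx hy ht.le ht.le).trans_le (hfg x y)
          simpa [div_eq_inv_mul] using lt_of_pow_lt_pow_left₀ 2 (by positivity) hxy
      _ = 2 * volume {z | t < h z} := by
          rw [Real.volume_preimage_mul_left (by norm_num)]
          norm_num
  · have hne' : ¬ ∃ y, t < g y := (hexists t ht).not.1 hne
    push Not at hne hne'
    simp [Set.eq_empty_of_forall_notMem, hne, hne', not_lt]

lemma four_mul_le_sq_add_ennreal (a b : ℝ≥0∞) : 4 * a * b ≤ (a + b) ^ 2 := by
  by_cases htop : a = ∞ ∨ b = ∞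
  · rcases htop with rfl | rfl <;> simp
  · push Not at htop
    lift a to ℝ≥0 using htop.1
    lift b to ℝ≥0 using htop.2
    exact_mod_cast four_mul_le_sq_add a b

lemma lintegral_mul_lintegral_le_sq_of_bddAbove {f g h : ℝ → ℝ≥0} (hf : Measurable f)
    (hg : Measurable g) (hh : Measurable h) (hf_bdd : BddAbove (Set.range f))
    (hg_bdd : BddAbove (Set.range g)) (hfg : ∀ x y, f x * g y ≤ h ((x + y) / 2) ^ 2) :
    (∫⁻ x, f x) * ∫⁻ y, g y ≤ (∫⁻ x, h x) ^ 2 := by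
  set a := ⨆ x, f x
  set b := ⨆ y, g y
  have ha' : ⨆ x, (f x : ℝ≥0∞) = a := (ENNReal.coe_iSup hf_bdd).symm
  have hb' : ⨆ y, (g y : ℝ≥0∞) = b := (ENNReal.coe_iSup hg_bdd).symm
  rcases eq_or_ne a 0 with h₀ | ha₀
  · simp [show ∀ x, f x = 0 from fun x => le_zero_iff.1 (h₀ ▸ le_ciSup hf_bdd x)]
  rcases eq_or_ne b 0 with h₀ | hb₀
  · simp [show ∀ y, g y = 0 from fun y => le_zero_iff.1 (h₀ ▸ le_ciSup hg_bdd y)]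
  -- Rescaling `f` and `g` by reciprocal factors equalizes their suprema and does not affect `h`.
  set c : ℝ≥0 := NNReal.sqrt (b / a) with hc
  have hc₀ : c ≠ 0 := by simp [hc, ha₀, hb₀]
  have hca : c * a = c⁻¹ * b := by
    rw [eq_inv_mul_iff_mul_eq₀ hc₀, ← mul_assoc, ← sq, hc, NNReal.sq_sqrt, div_mul_cancel₀ _ ha₀]
  have hadd := lintegral_add_lintegral_le_two_mul (f := fun x => c * f x)
    (g := fun y => c⁻¹ * g y) (hf.const_mul c) (hg.const_mul c⁻¹) hh
    (by simp only [ENNReal.coe_mul, ← ENNReal.mul_iSup, ha', hb']; exact_mod_cast hca)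
    (fun x y => by rw [mul_mul_mul_comm, mul_inv_cancel₀ hc₀, one_mul]; exact hfg x y)
  simp only [ENNReal.coe_mul] at hadd
  rw [lintegral_const_mul _ (by fun_prop), lintegral_const_mul _ (by fun_prop)] at hadd
  have hcc : (c : ℝ≥0∞) * (c⁻¹ : ℝ≥0) = 1 := by exact_mod_cast mul_inv_cancel₀ hc₀
  have hfour : 4 * ((∫⁻ x, f x) * ∫⁻ y, g y) ≤ 4 * (∫⁻ x, h x) ^ 2 :=
    calc 4 * ((∫⁻ x, f x) * ∫⁻ y, g y)
        = 4 * (c * ∫⁻ x, f x) * ((c⁻¹ : ℝ≥0) * ∫⁻ y, g y) := by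
          rw [mul_assoc, mul_mul_mul_comm, hcc, one_mul]
      _ ≤ (2 * ∫⁻ x, h x) ^ 2 := (four_mul_le_sq_add_ennreal _ _).trans (by gcongr)
      _ = 4 * (∫⁻ x, h x) ^ 2 := by rw [mul_pow]; norm_num
  exact (ENNReal.mul_le_mul_iff_right (by norm_num) (by norm_num)).1 hfour

lemma lintegral_mul_lintegral_le_sq {f g h : ℝ → ℝ≥0∞} (hf : Measurable f)
    (hg : Measurable g) (hh : Measurable h)
    (hfg : ∀ x y, f x * g y ≤ h ((x + y) / 2) ^ 2) :
    (∫⁻ x, f x) * ∫⁻ y, g y ≤ (∫⁻ x, h x) ^ 2 := by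
  have hmono (k : ℝ → ℝ≥0∞) : Monotone fun (n : ℕ) x => min (k x) n :=
    fun m n hmn x => min_le_min le_rfl (by exact_mod_cast hmn)
  have htrunc {k : ℝ → ℝ≥0∞} (hk : Measurable k) : ∫⁻ x, k x = ⨆ n : ℕ, ∫⁻ x, min (k x) n := by
    rw [← lintegral_iSup (fun n => hk.min measurable_const) (hmono k)]
    simp only [← inf_iSup_eq, ENNReal.iSup_natCast, inf_top_eq]
  have hcoe (k : ℝ → ℝ≥0∞) (n : ℕ) (x : ℝ) : ((min (k x) n).toNNReal : ℝ≥0∞) = min (k x) n :=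
    ENNReal.coe_toNNReal (by simp)
  have hbdd (k : ℝ → ℝ≥0∞) (n : ℕ) : BddAbove (Set.range fun x => (min (k x) n).toNNReal) := by
    refine ⟨n, ?_⟩
    rintro _ ⟨x, rfl⟩
    exact ENNReal.toNNReal_mono (ENNReal.natCast_ne_top n) (min_le_right _ _)
  simp_rw [htrunc hf, htrunc hg, ENNReal.iSup_mul, ENNReal.mul_iSup]
  refine iSup₂_le fun i j => ?_
  set n := max i j
  have hn := lintegral_mul_lintegral_le_sq_of_bddAbove
    (hf.min measurable_const).ennreal_toNNReal (hg.min measurable_const).ennreal_toNNReal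
    (hh.min measurable_const).ennreal_toNNReal (hbdd f n) (hbdd g n) (fun x y => by
      rw [← ENNReal.coe_le_coe, ENNReal.coe_mul, ENNReal.coe_pow, hcoe, hcoe, hcoe]
      rcases le_total (h ((x + y) / 2)) n with hle | hle
      · rw [min_eq_left hle]
        exact (mul_le_mul' (min_le_left _ _) (min_le_left _ _)).trans (hfg x y)
      · rw [min_eq_right hle, sq]
        exact mul_le_mul' (min_le_right _ _) (min_le_right _ _))
  simp only [hcoe] at hn
  calc (∫⁻ x, min (f x) i) * ∫⁻ y, min (g y) j
      ≤ (∫⁻ x, min (f x) n) * ∫⁻ y, min (g y) n :=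
        mul_le_mul' (lintegral_mono (hmono f (le_max_left i j)))
          (lintegral_mono (hmono g (le_max_right i j)))
    _ ≤ (∫⁻ x, h x) ^ 2 := hn.trans (by gcongr; exact min_le_left _ _)

end PrekopaLeindler

section PropertyTau

variable {α β : Type*} [MeasurableSpace α] [MeasurableSpace β]

/-- Maurey's property (τ) of a measure `μ` for the cost `c`: the exponential moments of two
functions whose sum is dominated by `c` multiply to at most one. The exponentials `F = exp u` and
`G = exp v` are the primitive objects here, so `u` and `v` may take the value `-∞`. -/
def PropertyTau (μ : Measure α) (c : α → α → ℝ) : Prop :=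
  ∀ ⦃F G : α → ℝ≥0∞⦄, Measurable F → Measurable G →
    (∀ x y, F x * G y ≤ ENNReal.ofReal (Real.exp (c x y))) →
    (∫⁻ x, F x ∂μ) * ∫⁻ y, G y ∂μ ≤ 1

lemma PropertyTau.map {μ : Measure α} {c : β → β → ℝ} {φ : α → β} (hφ : Measurable φ)
    (hμ : PropertyTau μ fun x y => c (φ x) (φ y)) : PropertyTau (μ.map φ) c := by
  intro F G hF hG hFG
  rw [lintegral_map hF hφ, lintegral_map hG hφ]
  exact hμ (hF.comp hφ) (hG.comp hφ) fun x y => hFG _ _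

lemma PropertyTau.prod {μ : Measure α} {ν : Measure β} [SFinite ν]
    {c : α → α → ℝ} {d : β → β → ℝ} (hμ : PropertyTau μ c) (hν : PropertyTau ν d) :
    PropertyTau (μ.prod ν) fun p q => c p.1 q.1 + d p.2 q.2 := by
  intro F G hF hG hFG
  rw [lintegral_prod _ hF.aemeasurable, lintegral_prod _ hG.aemeasurable]
  refine hμ hF.lintegral_prod_right' hG.lintegral_prod_right' fun a b => ?_
  set w := ENNReal.ofReal (Real.exp (c a b))
  have hw₀ : w ≠ 0 := by simpa [w] using Real.exp_pos _
  have hw : w ≠ ∞ := ENNReal.ofReal_ne_top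
  have hFa : Measurable fun x => F (a, x) := hF.comp measurable_prodMk_left
  have hslice := hν (hFa.const_mul w⁻¹) (hG.comp (measurable_prodMk_left (x := b))) fun x y => by
    rw [mul_assoc, ENNReal.inv_mul_le_iff hw₀ hw, ← ENNReal.ofReal_mul (Real.exp_pos _).le,
      ← Real.exp_add]
    exact hFG _ _
  rwa [lintegral_const_mul _ hFa, mul_assoc, ENNReal.inv_mul_le_iff hw₀ hw, mul_one] at hslice

lemma PropertyTau.pi {n : ℕ} {α : Fin n → Type*} [∀ i, MeasurableSpace (α i)]
    {μ : ∀ i, Measure (α i)} [∀ i, SigmaFinite (μ i)] {c : ∀ i, α i → α i → ℝ}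
    (hμ : ∀ i, PropertyTau (μ i) (c i)) :
    PropertyTau (Measure.pi μ) fun x y => ∑ i, c i (x i) (y i) := by
  induction n with
  | zero =>
    intro F G hF hG hFG
    rw [Measure.pi_of_empty μ isEmptyElim, lintegral_dirac' _ hF, lintegral_dirac' _ hG]
    simpa using hFG isEmptyElim isEmptyElim
  | succ n ih =>
    have hmp := (measurePreserving_piFinSuccAbove μ 0).symm
    rw [← hmp.map_eq]
    refine PropertyTau.map hmp.measurable ?_
    convert (hμ 0).prod (ih fun j => hμ (Fin.succAbove 0 j)) using 3 with p q
    exact Fin.sum_univ_succAbove _ 0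

lemma propertyTau_gaussianReal :
    PropertyTau (gaussianReal 0 1) fun z y => (z - y) ^ 2 / 4 := by
  intro F G hF hG hFG
  set φ := gaussianPDF 0 1
  have hφ : Measurable φ := measurable_gaussianPDF 0 1
  have hφ_mid (z y : ℝ) :
      ENNReal.ofReal (Real.exp ((z - y) ^ 2 / 4)) * (φ z * φ y) = φ ((z + y) / 2) ^ 2 := by
    simp only [φ, gaussianPDF, gaussianPDFReal_def]
    rw [← ENNReal.ofReal_mul (by positivity), ← ENNReal.ofReal_mul (by positivity),
      ← ENNReal.ofReal_pow (by positivity), mul_mul_mul_comm, ← Real.exp_add, mul_left_comm,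
      ← Real.exp_add, mul_pow, ← Real.exp_nat_mul, sq (_⁻¹)]
    congr 3
    push_cast
    ring
  rw [gaussianReal_of_var_ne_zero 0 one_ne_zero, lintegral_withDensity_eq_lintegral_mul _ hφ hF,
    lintegral_withDensity_eq_lintegral_mul _ hφ hG]
  refine (lintegral_mul_lintegral_le_sq (hφ.mul hF) (hφ.mul hG) hφ fun z y => ?_).trans ?_
  · calc (φ * F) z * (φ * G) y = F z * G y * (φ z * φ y) := by simp only [Pi.mul_apply]; ring
      _ ≤ φ ((z + y) / 2) ^ 2 := by rw [← hφ_mid]; gcongr; exact hFG z y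
  · rw [lintegral_gaussianPDF_eq_one 0 one_ne_zero, one_pow]

lemma propertyTau_stdGaussian (E : Type*) [NormedAddCommGroup E] [InnerProductSpace ℝ E]
    [FiniteDimensional ℝ E] [MeasurableSpace E] [BorelSpace E] :
    PropertyTau (stdGaussian E) fun z y => ‖z - y‖ ^ 2 / 4 := by
  set b := stdOrthonormalBasis ℝ E
  rw [← stdGaussian_map b.repr.symm, ← map_pi_eq_stdGaussian]
  refine .map (by fun_prop) (.map (by fun_prop) ?_)
  convert PropertyTau.pi fun _ => propertyTau_gaussianReal using 3 with z y
  rw [← map_sub, LinearIsometryEquiv.norm_map, EuclideanSpace.real_norm_sq_eq, Finset.sum_div]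
  simp

lemma ofReal_one_add_integral_le_lintegral_exp {μ : Measure α} [IsProbabilityMeasure μ]
    {f : α → ℝ} (hf : Integrable f μ) :
    ENNReal.ofReal (1 + ∫ x, f x ∂μ) ≤ ∫⁻ x, ENNReal.ofReal (Real.exp (f x)) ∂μ := by
  have hpos : Integrable (fun x => max (1 + f x) 0) μ := ((integrable_const 1).add hf).pos_part
  calc ENNReal.ofReal (1 + ∫ x, f x ∂μ) = ENNReal.ofReal (∫ x, (1 + f x) ∂μ) := by
        rw [integral_add (integrable_const 1) hf, integral_const, probReal_univ, one_smul]
    _ ≤ ENNReal.ofReal (∫ x, max (1 + f x) 0 ∂μ) := by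
        gcongr
        exacts [(integrable_const 1).add hf, fun x => le_max_left _ _]
    _ = ∫⁻ x, ENNReal.ofReal (max (1 + f x) 0) ∂μ :=
        ofReal_integral_eq_lintegral_ofReal hpos (ae_of_all _ fun x => le_max_right _ _)
    _ ≤ ∫⁻ x, ENNReal.ofReal (Real.exp (f x)) ∂μ := by
        gcongr with x
        exact max_le (add_comm (f x) 1 ▸ Real.add_one_le_exp (f x)) (Real.exp_pos _).le

lemma integral_nonpos_of_lintegral_exp_le_one {μ : Measure α} [IsProbabilityMeasure μ]
    {f : α → ℝ} (hf : Integrable f μ)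
    (hexp : ∫⁻ x, ENNReal.ofReal (Real.exp (f x)) ∂μ ≤ 1) : ∫ x, f x ∂μ ≤ 0 := by
  have hone := (ofReal_one_add_integral_le_lintegral_exp hf).trans hexp
  rw [ENNReal.ofReal_le_one] at hone
  linarith

lemma PropertyTau.lintegral_exp_le_one {E : Type*} [NormedAddCommGroup E] [InnerProductSpace ℝ E]
    [MeasurableSpace E] [OpensMeasurableSpace E] {μ : Measure E} [IsProbabilityMeasure μ]
    (hμ : PropertyTau μ fun z y => ‖z - y‖ ^ 2 / 4) {w : E → ℝ} {g : E → E} (hw : Measurable w)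
    (hg : Measurable g) (hw_int : Integrable w μ) (hsub : ∀ z y, w z + ⟪g z, y - z⟫ ≤ w y)
    {l : ℝ} (hl : 0 ≤ l) :
    ∫⁻ z, ENNReal.ofReal (Real.exp (l * w z - l ^ 2 * ‖g z‖ ^ 2 - l * ∫ y, w y ∂μ)) ∂μ ≤ 1 := by
  set m := ∫ y, w y ∂μ with hm
  have hG_int : Integrable (fun y => l * m - l * w y) μ :=
    (integrable_const _).sub (hw_int.const_mul l)
  have hG : 1 ≤ ∫⁻ y, ENNReal.ofReal (Real.exp (l * m - l * w y)) ∂μ := by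
    have hmean : ∫ y, (l * m - l * w y) ∂μ = 0 := by
      rw [integral_sub (integrable_const _) (hw_int.const_mul l), integral_const_mul l w, ← hm]
      simp
    simpa [hmean] using ofReal_one_add_integral_le_lintegral_exp hG_int
  refine (le_mul_of_one_le_right' hG).trans (hμ (by fun_prop) (by fun_prop) fun z y => ?_)
  rw [← ENNReal.ofReal_mul (Real.exp_pos _).le, ← Real.exp_add]
  gcongr
  have hlw : l * (w z + ⟪g z, y - z⟫) ≤ l * w y := by gcongr; exact hsub z y
  have hsq : 0 ≤ ‖(2 : ℝ)⁻¹ • (y - z) + l • g z‖ ^ 2 := sq_nonneg _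
  rw [norm_add_sq_real, norm_smul, norm_smul, real_inner_smul_left, real_inner_smul_right,
    mul_pow, mul_pow, Real.norm_eq_abs, Real.norm_eq_abs, sq_abs, sq_abs, real_inner_comm,
    norm_sub_rev] at hsq
  linarith

end PropertyTau

section Gaussian

variable {E : Type*} [NormedAddCommGroup E] [InnerProductSpace ℝ E]

/-- The Lebesgue density of the standard Gaussian measure on a finite-dimensional Euclidean
space. -/
noncomputable def stdGaussianPDF (x : E) : ℝ :=
  ((2 * Real.pi) ^ (Module.finrank ℝ E / 2 : ℝ))⁻¹ * Real.exp (-(1 / 2) * ‖x‖ ^ 2)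

lemma stdGaussianPDF_nonneg (x : E) : 0 ≤ stdGaussianPDF x := by
  unfold stdGaussianPDF
  positivity

lemma continuous_stdGaussianPDF : Continuous (stdGaussianPDF : E → ℝ) := by
  unfold stdGaussianPDF
  fun_prop

variable [FiniteDimensional ℝ E] [MeasurableSpace E] [BorelSpace E]

lemma integrable_stdGaussianPDF : Integrable (stdGaussianPDF : E → ℝ) := by
  have hcexp := GaussianFourier.integrable_cexp_neg_mul_sq_norm_add (V := E)
    (b := 1 / 2) (by norm_num) 0 0
  refine Integrable.const_mul (hcexp.re.congr (ae_of_all _ fun x => ?_)) _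
  simp only [zero_mul, add_zero]
  have hreal : (-(1 / 2) * (‖x‖ : ℂ) ^ 2) = ((-(1 / 2) * ‖x‖ ^ 2 : ℝ) : ℂ) := by push_cast; ring
  rw [hreal, ← Complex.ofReal_exp]
  exact Complex.ofReal_re _

lemma stdGaussian_eq_withDensity :
    stdGaussian E = volume.withDensity fun x => ENNReal.ofReal (stdGaussianPDF x) := by
  have : IsFiniteMeasure (volume.withDensity fun x : E => ENNReal.ofReal (stdGaussianPDF x)) :=
    isFiniteMeasure_withDensity_ofReal integrable_stdGaussianPDF.2
  refine Measure.ext_of_charFun ?_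
  ext t
  set c : ℝ := (2 * Real.pi) ^ (Module.finrank ℝ E / 2 : ℝ) with hc
  have hc₀ : (c : ℂ) ≠ 0 := by exact_mod_cast (by positivity : c ≠ 0)
  have hpi : ((Real.pi : ℂ) / (1 / 2)) ^ ((Module.finrank ℝ E : ℂ) / 2) = c := by
    rw [hc, Complex.ofReal_cpow (by positivity)]
    simp [mul_comm]
  have hintegrand (x : E) :
      (ENNReal.ofReal (stdGaussianPDF x)).toReal • Complex.exp (⟪x, t⟫ * Complex.I) =
        (c : ℂ)⁻¹ * Complex.exp (-(1 / 2) * (‖x‖ : ℂ) ^ 2 + Complex.I * ⟪t, x⟫) := by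
    rw [ENNReal.toReal_ofReal (stdGaussianPDF_nonneg x), stdGaussianPDF, ← hc,
      Complex.exp_add, Complex.real_smul, real_inner_comm]
    push_cast
    ring_nf
  rw [charFun_stdGaussian, charFun_apply, integral_withDensity_eq_integral_toReal_smul
    continuous_stdGaussianPDF.measurable.ennreal_ofReal (by simp)]
  simp_rw [hintegrand]
  rw [integral_const_mul, GaussianFourier.integral_cexp_neg_mul_sq_norm_add (by norm_num), hpi,
    inv_mul_cancel_left₀ hc₀, Complex.I_sq]
  congr 1
  ring

lemma stdGaussian_absolutelyContinuous : stdGaussian E ≪ volume := by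
  rw [stdGaussian_eq_withDensity]
  exact withDensity_absolutelyContinuous _ _

lemma lintegral_stdGaussian {F : E → ℝ≥0∞} (hF : Measurable F) :
    ∫⁻ z, F z ∂stdGaussian E = ∫⁻ z, ENNReal.ofReal (stdGaussianPDF z) * F z := by
  rw [stdGaussian_eq_withDensity, lintegral_withDensity_eq_lintegral_mul _
    continuous_stdGaussianPDF.measurable.ennreal_ofReal hF]
  rfl

lemma lintegral_exp_mul_comp_add_stdGaussian {F : E → ℝ≥0∞} (hF : Measurable F) (m : E) :
    ∫⁻ z, ENNReal.ofReal (Real.exp (-⟪z, m⟫ - ‖m‖ ^ 2 / 2)) * F (z + m) ∂stdGaussian E =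
      ∫⁻ z, F z ∂stdGaussian E := by
  rw [lintegral_stdGaussian hF, lintegral_stdGaussian (by fun_prop),
    ← lintegral_add_right_eq_self (fun z => ENNReal.ofReal (stdGaussianPDF z) * F z) m]
  refine lintegral_congr fun z => ?_
  rw [← mul_assoc, ← ENNReal.ofReal_mul (stdGaussianPDF_nonneg z)]
  congr 2
  rw [stdGaussianPDF, stdGaussianPDF, mul_assoc, ← Real.exp_add, norm_add_sq_real]
  ring_nf

lemma lintegral_prod_exp_mul_comp_add_stdGaussian {α : Type*} [MeasurableSpace α] {ν : Measure α}
    {m : α → E} (hm : Measurable m) {F : α × E → ℝ≥0∞} (hF : Measurable F) :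
    ∫⁻ p, ENNReal.ofReal (Real.exp (-⟪p.2, m p.1⟫ - ‖m p.1‖ ^ 2 / 2)) * F (p.1, p.2 + m p.1)
        ∂ν.prod (stdGaussian E) =
      ∫⁻ p, F p ∂ν.prod (stdGaussian E) := by
  rw [lintegral_prod _ (by fun_prop), lintegral_prod _ hF.aemeasurable]
  exact lintegral_congr fun x =>
    lintegral_exp_mul_comp_add_stdGaussian (hF.comp measurable_prodMk_left) (m x)

lemma integrable_inner_stdGaussian (v : E) : Integrable (fun z => ⟪z, v⟫) (stdGaussian E) :=
  (IsGaussian.memLp_two_id.integrable one_le_two).inner_const v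

lemma integral_inner_stdGaussian (v : E) : ∫ z, ⟪z, v⟫ ∂stdGaussian E = 0 := by
  simpa [real_inner_comm] using integral_strongDual_stdGaussian (innerSL ℝ v)

end Gaussian

section Risk

variable {E : Type*} [NormedAddCommGroup E] [InnerProductSpace ℝ E] [FiniteDimensional ℝ E]
  {δ δ' : E → E} [MeasurableSpace E] [BorelSpace E]

/-- The quadratic risk at `θ` of the estimator `δ` from the observation `θ + Z`, with `Z` a
standard Gaussian vector of a finite-dimensional Euclidean space. -/
noncomputable def gaussianRisk (δ : E → E) (θ : E) : ℝ≥0∞ :=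
  ∫⁻ z, ENNReal.ofReal (‖δ (θ + z) - θ‖ ^ 2) ∂stdGaussian E

lemma risk_eq_gaussianRisk {n : ℕ} (δ : EuclideanSpace ℝ (Fin n) → EuclideanSpace ℝ (Fin n))
    (θ : EuclideanSpace ℝ (Fin n)) : risk δ θ = gaussianRisk δ θ := by
  have hlaw : law θ = (stdGaussian (EuclideanSpace ℝ (Fin n))).map (θ + ·) := by
    simp [law, multivariateGaussian]
  rw [risk, hlaw, (measurableEmbedding_addLeft θ).lintegral_map, gaussianRisk]

lemma gaussianRisk_congr (h : δ =ᵐ[volume] δ') (θ : E) :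
    gaussianRisk δ θ = gaussianRisk δ' θ := by
  have hshift : ∀ᵐ z ∂(volume : Measure E), δ (θ + z) = δ' (θ + z) :=
    (measurePreserving_add_left volume θ).quasiMeasurePreserving.ae h
  refine lintegral_congr_ae ?_
  filter_upwards [stdGaussian_absolutelyContinuous.ae_le hshift] with z hz
  rw [hz]

lemma lowerSemicontinuous_gaussianRisk (hδ : Measurable δ) :
    LowerSemicontinuous (gaussianRisk δ) := by
  have hdensity : gaussianRisk δ = fun θ =>
      ∫⁻ x, ENNReal.ofReal (stdGaussianPDF (x - θ)) * ENNReal.ofReal (‖δ x - θ‖ ^ 2) := by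
    ext θ
    rw [gaussianRisk, lintegral_stdGaussian (by fun_prop), eq_comm,
      ← lintegral_add_left_eq_self _ θ]
    simp only [add_sub_cancel_left]
  have hmeas (θ : E) : Measurable fun x =>
      ENNReal.ofReal (stdGaussianPDF (x - θ)) * ENNReal.ofReal (‖δ x - θ‖ ^ 2) :=
    (continuous_stdGaussianPDF.measurable.comp (by fun_prop)).ennreal_ofReal.mul (by fun_prop)
  have hcont (x : E) : Continuous fun θ =>
      ENNReal.ofReal (stdGaussianPDF (x - θ)) * ENNReal.ofReal (‖δ x - θ‖ ^ 2) := by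
    simp_rw [← ENNReal.ofReal_mul (stdGaussianPDF_nonneg _)]
    exact ENNReal.continuous_ofReal.comp
      ((continuous_stdGaussianPDF.comp (by fun_prop)).mul (by fun_prop))
  refine lowerSemicontinuous_iff_le_liminf.2 fun θ => ?_
  rw [hdensity]
  refine le_trans ?_ (lintegral_liminf_le hmeas)
  exact lintegral_mono fun x => ((hcont x).tendsto θ).liminf_eq.ge

end Risk

section Prox

variable {E : Type*} [NormedAddCommGroup E] [InnerProductSpace ℝ E] {Θ : Set E} {f : E → ℝ}
  {x y p q α : E}

/-- `p` is a proximal point of `x` for the penalty `f` and the constraint set `Θ`: it minimizes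
the penalized least squares objective. -/
def IsProxPoint (Θ : Set E) (f : E → ℝ) (x p : E) : Prop :=
  p ∈ Θ ∧ IsMinOn (fun α => (1 / 2 : ℝ) * ‖x - α‖ ^ 2 + f α) Θ p

lemma IsProxPoint.inner_sub_le (hf : ConvexOn ℝ Θ f) (hp : IsProxPoint Θ f x p) (hα : α ∈ Θ) :
    ⟪x - p, α - p⟫ ≤ f α - f p := by
  have hsegment : ∀ t ∈ Set.Ioc (0 : ℝ) 1,
      ⟪x - p, α - p⟫ ≤ f α - f p + t / 2 * ‖α - p‖ ^ 2 := by
    rintro t ⟨ht₀, ht₁⟩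
    have hmin := isMinOn_iff.1 hp.2 _
      (hf.1 hp.1 hα (by linarith : 0 ≤ 1 - t) ht₀.le (by ring))
    have hconv := hf.2 hp.1 hα (by linarith : 0 ≤ 1 - t) ht₀.le (by ring)
    have hx : x - ((1 - t) • p + t • α) = (x - p) - t • (α - p) := by module
    rw [hx, norm_sub_sq_real (x - p), real_inner_smul_right, norm_smul, mul_pow, Real.norm_eq_abs,
      sq_abs] at hmin
    rw [smul_eq_mul, smul_eq_mul] at hconv
    refine le_of_mul_le_mul_left ?_ ht₀
    linarith
  have hlim : Tendsto (fun t : ℝ => f α - f p + t / 2 * ‖α - p‖ ^ 2) (𝓝[>] 0)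
      (𝓝 (f α - f p)) := by
    have hcont : Continuous fun t : ℝ => f α - f p + t / 2 * ‖α - p‖ ^ 2 := by fun_prop
    simpa using (hcont.tendsto 0).mono_left nhdsWithin_le_nhds
  refine ge_of_tendsto hlim ?_
  filter_upwards [Ioc_mem_nhdsGT one_pos] using hsegment

lemma IsProxPoint.norm_sub_le (hf : ConvexOn ℝ Θ f) (hp : IsProxPoint Θ f x p)
    (hq : IsProxPoint Θ f y q) : ‖p - q‖ ≤ ‖x - y‖ := by
  have hpq := hp.inner_sub_le hf hq.1
  have hqp := hq.inner_sub_le hf hp.1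
  have hsum : ⟪x - p, q - p⟫ + ⟪y - q, p - q⟫ = ‖p - q‖ ^ 2 - ⟪x - y, p - q⟫ := by
    rw [← real_inner_self_eq_norm_sq]
    simp only [inner_sub_left, inner_sub_right]
    ring
  have hcs := real_inner_le_norm (x - y) (p - q)
  rcases (norm_nonneg (p - q)).eq_or_lt with hzero | hpos
  · exact hzero ▸ norm_nonneg _
  · refine le_of_mul_le_mul_right ?_ hpos
    linarith

/-- The convex conjugate of `f + ½‖·‖²` on `Θ`, of which the proximal map is a gradient. It takes
the junk value of an unbounded supremum where it should be infinite. -/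
noncomputable def proxPotential (Θ : Set E) (f : E → ℝ) (x : E) : ℝ :=
  ⨆ α : Θ, (⟪x, (α : E)⟫ - f α - ‖(α : E)‖ ^ 2 / 2)

lemma inner_sub_sub_le {M : ℝ} (hM : M ∈ lowerBounds (f '' Θ)) (x : E) (α : Θ) :
    ⟪x, (α : E)⟫ - f α - ‖(α : E)‖ ^ 2 / 2 ≤ ‖x‖ ^ 2 / 2 - M := by
  have hfα := hM (Set.mem_image_of_mem f α.2)
  have hsq : 0 ≤ ‖x - α‖ ^ 2 := sq_nonneg _
  rw [norm_sub_sq_real] at hsq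
  linarith

lemma bddAbove_range_inner_sub_sub (hfb : BddBelow (f '' Θ)) (x : E) :
    BddAbove (Set.range fun α : Θ => ⟪x, (α : E)⟫ - f α - ‖(α : E)‖ ^ 2 / 2) :=
  have ⟨M, hM⟩ := hfb
  ⟨‖x‖ ^ 2 / 2 - M, Set.forall_mem_range.2 (inner_sub_sub_le hM x)⟩

lemma exists_forall_proxPotential_le (hne : Θ.Nonempty) (hfb : BddBelow (f '' Θ)) :
    ∃ M, ∀ x, proxPotential Θ f x ≤ ‖x‖ ^ 2 / 2 + M := by
  obtain ⟨M, hM⟩ := hfb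
  have := hne.to_subtype
  exact ⟨-M, fun x => ciSup_le (inner_sub_sub_le hM x)⟩

lemma lowerSemicontinuous_proxPotential (hfb : BddBelow (f '' Θ)) :
    LowerSemicontinuous (proxPotential Θ f) :=
  lowerSemicontinuous_ciSup (bddAbove_range_inner_sub_sub hfb) fun α =>
    Continuous.lowerSemicontinuous (by fun_prop)

lemma IsProxPoint.proxPotential_add_inner_le (hfb : BddBelow (f '' Θ)) (hp : IsProxPoint Θ f x p)
    (y : E) : proxPotential Θ f x + ⟪p, y - x⟫ ≤ proxPotential Θ f y := by
  have : Nonempty Θ := ⟨p, hp.1⟩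
  have hx : proxPotential Θ f x ≤ ⟪x, p⟫ - f p - ‖p‖ ^ 2 / 2 := by
    refine ciSup_le fun α => ?_
    have hmin := isMinOn_iff.1 hp.2 α α.2
    rw [norm_sub_sq_real, norm_sub_sq_real] at hmin
    linarith
  have hy : ⟪y, p⟫ - f p - ‖p‖ ^ 2 / 2 ≤ proxPotential Θ f y :=
    le_ciSup (bddAbove_range_inner_sub_sub hfb y) ⟨p, hp.1⟩
  rw [inner_sub_right, real_inner_comm y, real_inner_comm x]
  linarith

end Prox

section NonexpansiveGradient

variable {E : Type*} [NormedAddCommGroup E] [InnerProductSpace ℝ E] {P : E → E} {u : E → ℝ}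

/-- `P` is a nonexpansive selection of the subdifferential of the (necessarily convex) function
`u`. These are the only properties of the proximal map that the risk bounds use. -/
structure IsNonexpansiveGradient (P : E → E) (u : E → ℝ) : Prop where
  lipschitz : LipschitzWith 1 P
  add_inner_le : ∀ x y, u x + ⟪P x, y - x⟫ ≤ u y

namespace IsNonexpansiveGradient

lemma norm_sub_le (h : IsNonexpansiveGradient P u) (x y : E) : ‖P x - P y‖ ≤ ‖x - y‖ := by
  simpa using h.lipschitz.norm_sub_le x y

lemma le_add_inner_add_sq (h : IsNonexpansiveGradient P u) (x y : E) :
    u y ≤ u x + ⟪P x, y - x⟫ + ‖y - x‖ ^ 2 := by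
  have hyx := h.add_inner_le y x
  have hcs : ⟪P y - P x, y - x⟫ ≤ ‖y - x‖ * ‖y - x‖ :=
    (real_inner_le_norm _ _).trans (by gcongr; exact h.norm_sub_le y x)
  rw [← neg_sub y x, inner_neg_right] at hyx
  rw [inner_sub_left] at hcs
  linarith

lemma continuous (h : IsNonexpansiveGradient P u) : Continuous u := by
  refine continuous_iff_continuousAt.2 fun x => ?_
  have hlower : Continuous fun y => u x + ⟪P x, y - x⟫ := by fun_prop
  have hupper : Continuous fun y => u x + ⟪P x, y - x⟫ + ‖y - x‖ ^ 2 := by fun_prop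
  refine tendsto_of_tendsto_of_tendsto_of_le_of_le (by simpa using hlower.tendsto x)
    (by simpa using hupper.tendsto x) (h.add_inner_le x) (h.le_add_inner_add_sq x)

end IsNonexpansiveGradient

lemma exists_isNonexpansiveGradient_of_dense [FiniteDimensional ℝ E] {S : Set E} {δ : E → E}
    (hS : Dense S) (hδ : LipschitzOnWith 1 δ S)
    (hu : LowerSemicontinuous u) (hsub : ∀ x ∈ S, ∀ y, u x + ⟪δ x, y - x⟫ ≤ u y) :
    ∃ P, IsNonexpansiveGradient P u ∧ Set.EqOn δ P S := by
  obtain ⟨P, hP, hδP⟩ := hδ.extend_finite_dimension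
  refine ⟨P, ⟨?_, fun x y => ?_⟩, hδP⟩
  · rw [← lipschitzOnWith_univ, ← hS.closure_eq, lipschitzOnWith_closure_iff
      hP.continuous.continuousOn]
    intro x hx y hy
    rw [← hδP hx, ← hδP hy]
    exact hδ hx hy
  · have hlsc : LowerSemicontinuous fun x => u x + ⟪P x, y - x⟫ :=
      hu.add (Continuous.lowerSemicontinuous (by have := hP.continuous; fun_prop))
    refine hS.induction (P := fun x => u x + ⟪P x, y - x⟫ ≤ u y) (fun x hx => ?_)
      (hlsc.isClosed_preimage (u y)) x
    exact hδP hx ▸ hsub x hx y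

lemma exists_isNonexpansiveGradient_proxPotential [FiniteDimensional ℝ E] [MeasurableSpace E]
    [BorelSpace E] {Θ : Set E} {f : E → ℝ} {δ : E → E} (hf : ConvexOn ℝ Θ f)
    (hfb : BddBelow (f '' Θ)) (hδ : ∀ᵐ x, IsProxPoint Θ f x (δ x)) :
    ∃ P, IsNonexpansiveGradient P (proxPotential Θ f) ∧ δ =ᵐ[volume] P := by
  have hlip : LipschitzOnWith 1 δ {x | IsProxPoint Θ f x (δ x)} :=
    LipschitzOnWith.of_dist_le_mul fun x hx y hy => by
      simpa [dist_eq_norm] using IsProxPoint.norm_sub_le hf hx hy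
  obtain ⟨P, hP, hδP⟩ := exists_isNonexpansiveGradient_of_dense (Measure.dense_of_ae hδ) hlip
    (lowerSemicontinuous_proxPotential hfb)
    fun x hx => hx.proxPotential_add_inner_le hfb
  exact ⟨P, hP, hδ.mono fun x hx => hδP hx⟩

end NonexpansiveGradient

section LipschitzDisplacement

variable {E : Type*} [SeminormedAddCommGroup E] {P : E → E}

lemma norm_comp_add_sub_sq_le (hP : LipschitzWith 1 P) (θ ϑ z : E) :
    ‖P (ϑ + z) - ϑ‖ ^ 2 ≤ 2 * ‖P (θ + z) - θ‖ ^ 2 + 8 * ‖ϑ - θ‖ ^ 2 := by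
  have hlip : ‖P (ϑ + z) - P (θ + z)‖ ≤ ‖ϑ - θ‖ := by
    simpa using hP.norm_sub_le (ϑ + z) (θ + z)
  have htri : ‖P (ϑ + z) - ϑ‖ ≤ ‖P (θ + z) - θ‖ + 2 * ‖ϑ - θ‖ := by
    calc ‖P (ϑ + z) - ϑ‖ = ‖(P (θ + z) - θ) + (P (ϑ + z) - P (θ + z)) - (ϑ - θ)‖ := by
          congr 1; abel
      _ ≤ ‖P (θ + z) - θ‖ + ‖P (ϑ + z) - P (θ + z)‖ + ‖ϑ - θ‖ :=
          (norm_sub_le _ _).trans (by gcongr; exact norm_add_le _ _)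
      _ ≤ ‖P (θ + z) - θ‖ + 2 * ‖ϑ - θ‖ := by linarith
  refine (pow_le_pow_left₀ (norm_nonneg _) htri 2).trans ?_
  nlinarith [sq_nonneg (‖P (θ + z) - θ‖ - 2 * ‖ϑ - θ‖)]

lemma one_le_norm_comp_add_sub_add (hP : LipschitzWith 1 P) {θ₁ θ₂ v : E}
    (hv : ‖θ₁ - θ₂ - v‖ + 1 ≤ ‖θ₁ - θ₂‖) (z : E) :
    1 ≤ ‖P (θ₁ + z) - θ₁‖ + ‖P (θ₂ + (z + v)) - θ₂‖ := by
  have hlip : ‖P (θ₁ + z) - P (θ₂ + (z + v))‖ ≤ ‖θ₁ - θ₂ - v‖ := by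
    convert hP.norm_sub_le (θ₁ + z) (θ₂ + (z + v)) using 1
    rw [NNReal.coe_one, one_mul]
    congr 1
    abel
  have htri : ‖θ₁ - θ₂‖ ≤
      ‖P (θ₁ + z) - P (θ₂ + (z + v))‖ + ‖P (θ₂ + (z + v)) - θ₂‖ + ‖P (θ₁ + z) - θ₁‖ := by
    calc ‖θ₁ - θ₂‖ = ‖(P (θ₁ + z) - P (θ₂ + (z + v))) + (P (θ₂ + (z + v)) - θ₂)
          - (P (θ₁ + z) - θ₁)‖ := by congr 1; abel
      _ ≤ _ := (norm_sub_le _ _).trans (by gcongr; exact norm_add_le _ _)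
  linarith

lemma norm_comp_add_sub_sq_le_add (hP : LipschitzWith 1 P) (θ d z : E) :
    ‖P (d + z) - θ‖ ^ 2 ≤ 8 * ‖P (θ + z) - θ‖ ^ 2 + 2 * ‖d - P (θ + z)‖ ^ 2 := by
  have hlip : ‖P (d + z) - P (θ + z)‖ ≤ ‖d - θ‖ := by
    simpa using hP.norm_sub_le (d + z) (θ + z)
  have htri : ‖P (d + z) - θ‖ ≤ ‖d - P (θ + z)‖ + 2 * ‖P (θ + z) - θ‖ := by
    linarith [norm_sub_le_norm_sub_add_norm_sub (P (d + z)) (P (θ + z)) θ,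
      norm_sub_le_norm_sub_add_norm_sub d (P (θ + z)) θ]
  refine (pow_le_pow_left₀ (norm_nonneg _) htri 2).trans ?_
  nlinarith [sq_nonneg (‖d - P (θ + z)‖ - 2 * ‖P (θ + z) - θ‖)]

end LipschitzDisplacement

section UnitStep

variable {E : Type*} [NormedAddCommGroup E] [InnerProductSpace ℝ E]

lemma exists_norm_eq_one_norm_sub_add_one_le {F : Type*} [NormedAddCommGroup F] [NormedSpace ℝ F]
    {a : F} (ha : 1 ≤ ‖a‖) : ∃ v : F, ‖v‖ = 1 ∧ ‖a - v‖ + 1 ≤ ‖a‖ := by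
  have hpos : 0 < ‖a‖ := by linarith
  refine ⟨‖a‖⁻¹ • a, by rw [norm_smul, norm_inv, norm_norm, inv_mul_cancel₀ hpos.ne'], ?_⟩
  have hsub : a - ‖a‖⁻¹ • a = (1 - ‖a‖⁻¹) • a := by rw [sub_smul, one_smul]
  rw [hsub, norm_smul, Real.norm_of_nonneg (sub_nonneg.2 (inv_le_one_of_one_le₀ ha)), sub_mul,
    inv_mul_cancel₀ hpos.ne']
  linarith

lemma exp_neg_norm_sub_half_le {v : E} (hv : ‖v‖ = 1) (z : E) {x y : ℝ} (hxy : 1 ≤ x + y) :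
    Real.exp (-‖z‖ - 1 / 2) ≤
      2 * (x ^ 2 + Real.exp (-⟪z, v⟫ - ‖v‖ ^ 2 / 2) * y ^ 2) := by
  have hinner : ⟪z, v⟫ ≤ ‖z‖ := by simpa [hv] using real_inner_le_norm z v
  have hweight : Real.exp (-‖z‖ - 1 / 2) ≤ Real.exp (-⟪z, v⟫ - ‖v‖ ^ 2 / 2) := by
    rw [hv]
    gcongr
    norm_num
  have hone : Real.exp (-‖z‖ - 1 / 2) ≤ 1 := Real.exp_le_one_iff.2 (by linarith [norm_nonneg z])
  have hsq : 1 ≤ 2 * (x ^ 2 + y ^ 2) := by nlinarith [sq_nonneg (x - y)]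
  calc Real.exp (-‖z‖ - 1 / 2) ≤ Real.exp (-‖z‖ - 1 / 2) * (2 * (x ^ 2 + y ^ 2)) :=
        le_mul_of_one_le_right (Real.exp_pos _).le hsq
    _ = 2 * (Real.exp (-‖z‖ - 1 / 2) * x ^ 2 + Real.exp (-‖z‖ - 1 / 2) * y ^ 2) := by ring
    _ ≤ 2 * (1 * x ^ 2 + Real.exp (-⟪z, v⟫ - ‖v‖ ^ 2 / 2) * y ^ 2) := by gcongr
    _ = 2 * (x ^ 2 + Real.exp (-⟪z, v⟫ - ‖v‖ ^ 2 / 2) * y ^ 2) := by rw [one_mul]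

end UnitStep

section LipschitzRisk

variable {E : Type*} [NormedAddCommGroup E] [InnerProductSpace ℝ E] [FiniteDimensional ℝ E]
  [MeasurableSpace E] {P : E → E} {Θ : Set E}

local notation "γ" => stdGaussian E

/-- The quadratic risk of `P` at `θ` as a real number. It takes the junk value `0` where
`gaussianRisk P θ` is infinite, which does not happen for Lipschitz `P`. -/
noncomputable def realRisk (P : E → E) (θ : E) : ℝ :=
  ∫ z, ‖P (θ + z) - θ‖ ^ 2 ∂γ

lemma realRisk_nonneg (P : E → E) (θ : E) : 0 ≤ realRisk P θ :=
  integral_nonneg fun _ => sq_nonneg _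

variable [BorelSpace E]

lemma memLp_two_comp_add_sub (hP : LipschitzWith 1 P) (θ α : E) :
    MemLp (fun z => P (θ + z) - α) 2 γ := by
  have hc := hP.continuous
  refine ((memLp_const ‖P θ - α‖).add IsGaussian.memLp_two_id.norm).mono'
    (by fun_prop) (ae_of_all _ fun z => ?_)
  have hlip : ‖P (θ + z) - P θ‖ ≤ ‖z‖ := by simpa using hP.norm_sub_le (θ + z) θ
  calc ‖P (θ + z) - α‖ = ‖(P θ - α) + (P (θ + z) - P θ)‖ := by congr 1; abel
    _ ≤ ‖P θ - α‖ + ‖z‖ := (norm_add_le _ _).trans (by gcongr)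

lemma integrable_norm_comp_add_sub_sq (hP : LipschitzWith 1 P) (θ α : E) :
    Integrable (fun z => ‖P (θ + z) - α‖ ^ 2) γ :=
  (memLp_two_comp_add_sub hP θ α).integrable_norm_pow two_ne_zero

lemma integrable_lipschitz_comp_add (hP : LipschitzWith 1 P) (θ : E) :
    Integrable (fun z => P (θ + z)) γ := by
  simpa using (memLp_two_comp_add_sub hP θ 0).integrable one_le_two

lemma gaussianRisk_eq_ofReal_realRisk (hP : LipschitzWith 1 P) (θ : E) :
    gaussianRisk P θ = ENNReal.ofReal (realRisk P θ) :=
  (ofReal_integral_eq_lintegral_ofReal (integrable_norm_comp_add_sub_sq hP θ θ)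
    (ae_of_all _ fun _ => sq_nonneg _)).symm

lemma realRisk_le (hP : LipschitzWith 1 P) (θ ϑ : E) :
    realRisk P ϑ ≤ 2 * realRisk P θ + 8 * ‖ϑ - θ‖ ^ 2 := by
  have hint := integrable_norm_comp_add_sub_sq hP θ θ
  calc realRisk P ϑ ≤ ∫ z, (2 * ‖P (θ + z) - θ‖ ^ 2 + 8 * ‖ϑ - θ‖ ^ 2) ∂γ :=
        integral_mono (integrable_norm_comp_add_sub_sq hP ϑ ϑ) (by fun_prop) fun z =>
          norm_comp_add_sub_sq_le hP θ ϑ z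
    _ = 2 * realRisk P θ + 8 * ‖ϑ - θ‖ ^ 2 := by
        rw [integral_add (by fun_prop) (by fun_prop), integral_const_mul]
        simp [realRisk]

lemma continuous_realRisk (hP : LipschitzWith 1 P) : Continuous (realRisk P) := by
  have hc := hP.continuous
  refine continuous_iff_continuousAt.2 fun θ => ?_
  have hint := integrable_norm_comp_add_sub_sq hP θ θ
  refine continuousAt_of_dominated (bound := fun z => 2 * ‖P (θ + z) - θ‖ ^ 2 + 8)
    (Eventually.of_forall fun ϑ => by fun_prop) ?_ (by fun_prop)
    (ae_of_all _ fun z => by fun_prop)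
  filter_upwards [Metric.ball_mem_nhds θ one_pos] with ϑ hϑ
  refine ae_of_all _ fun z => ?_
  have hdist : ‖ϑ - θ‖ ^ 2 ≤ 1 :=
    pow_le_one₀ (norm_nonneg _) (mem_ball_iff_norm.1 hϑ).le
  rw [Real.norm_of_nonneg (sq_nonneg _)]
  linarith [norm_comp_add_sub_sq_le hP θ ϑ z]

lemma lintegral_exp_neg_norm_le_realRisk_add (hP : LipschitzWith 1 P) {θ₁ θ₂ : E}
    (hθ : 1 ≤ ‖θ₁ - θ₂‖) :
    ∫⁻ z, ENNReal.ofReal (Real.exp (-‖z‖ - 1 / 2)) ∂γ ≤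
      ENNReal.ofReal (2 * (realRisk P θ₁ + realRisk P θ₂)) := by
  obtain ⟨v, hv, hshift⟩ := exists_norm_eq_one_norm_sub_add_one_le hθ
  have hc := hP.continuous
  calc ∫⁻ z, ENNReal.ofReal (Real.exp (-‖z‖ - 1 / 2)) ∂γ
      ≤ ∫⁻ z, ENNReal.ofReal 2 * (ENNReal.ofReal (‖P (θ₁ + z) - θ₁‖ ^ 2) +
          ENNReal.ofReal (Real.exp (-⟪z, v⟫ - ‖v‖ ^ 2 / 2)) *
            ENNReal.ofReal (‖P (θ₂ + (z + v)) - θ₂‖ ^ 2)) ∂γ := by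
        refine lintegral_mono fun z => ?_
        rw [← ENNReal.ofReal_mul (by positivity), ← ENNReal.ofReal_add (by positivity)
          (by positivity), ← ENNReal.ofReal_mul (by positivity)]
        exact ENNReal.ofReal_le_ofReal
          (exp_neg_norm_sub_half_le hv z (one_le_norm_comp_add_sub_add hP hshift z))
    _ = ENNReal.ofReal 2 * (gaussianRisk P θ₁ + gaussianRisk P θ₂) := by
        rw [lintegral_const_mul _ (by fun_prop), lintegral_add_left (by fun_prop),
          lintegral_exp_mul_comp_add_stdGaussian
            (F := fun z => ENNReal.ofReal (‖P (θ₂ + z) - θ₂‖ ^ 2)) (by fun_prop) v]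
        rfl
    _ = ENNReal.ofReal (2 * (realRisk P θ₁ + realRisk P θ₂)) := by
        rw [gaussianRisk_eq_ofReal_realRisk hP, gaussianRisk_eq_ofReal_realRisk hP,
          ← ENNReal.ofReal_add (realRisk_nonneg P θ₁) (realRisk_nonneg P θ₂),
          ← ENNReal.ofReal_mul zero_le_two]

lemma exists_pos_le_realRisk_or (hP : LipschitzWith 1 P) :
    ∃ c > 0, ∀ θ₁ θ₂, 1 ≤ ‖θ₁ - θ₂‖ → c ≤ realRisk P θ₁ ∨ c ≤ realRisk P θ₂ := by
  have hint : Integrable (fun z : E => Real.exp (-‖z‖ - 1 / 2)) γ := by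
    refine (integrable_const (1 : ℝ)).mono' (by fun_prop) (ae_of_all _ fun z => ?_)
    rw [Real.norm_eq_abs, Real.abs_exp, Real.exp_le_one_iff]
    linarith [norm_nonneg z]
  have hpos : 0 < ∫ z : E, Real.exp (-‖z‖ - 1 / 2) ∂γ := integral_exp_pos hint
  refine ⟨(∫ z : E, Real.exp (-‖z‖ - 1 / 2) ∂γ) / 4, by positivity, fun θ₁ θ₂ hθ => ?_⟩
  have hle := lintegral_exp_neg_norm_le_realRisk_add hP hθ
  rw [← ofReal_integral_eq_lintegral_ofReal hint (ae_of_all _ fun z => (Real.exp_pos _).le),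
    ENNReal.ofReal_le_ofReal_iff
      (mul_nonneg zero_le_two (add_nonneg (realRisk_nonneg P θ₁) (realRisk_nonneg P θ₂)))] at hle
  by_contra! hsmall
  linarith [hsmall.1, hsmall.2]

lemma exists_pos_le_realRisk (hP : LipschitzWith 1 P) (hΘ : IsClosed Θ)
    (hpos : ∀ θ ∈ Θ, 0 < realRisk P θ) : ∃ r > 0, ∀ θ ∈ Θ, r ≤ realRisk P θ := by
  obtain ⟨c, hc, hsep⟩ := exists_pos_le_realRisk_or hP
  by_cases hsmall : ∃ θ₀ ∈ Θ, realRisk P θ₀ < c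
  · obtain ⟨θ₀, hθ₀, hlt⟩ := hsmall
    have hcompact : IsCompact (Metric.closedBall θ₀ 1 ∩ Θ) :=
      (isCompact_closedBall θ₀ 1).inter_right hΘ
    obtain ⟨θ₁, hθ₁, hmin⟩ := hcompact.exists_isMinOn ⟨θ₀, by simp, hθ₀⟩
      (continuous_realRisk hP).continuousOn
    refine ⟨min c (realRisk P θ₁), lt_min hc (hpos θ₁ hθ₁.2), fun θ hθ => ?_⟩
    by_cases hball : θ ∈ Metric.closedBall θ₀ 1
    · exact (min_le_right _ _).trans (isMinOn_iff.1 hmin θ ⟨hball, hθ⟩)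
    · rw [mem_closedBall_iff_norm, not_le] at hball
      exact (min_le_left _ _).trans ((hsep θ θ₀ hball.le).resolve_right hlt.not_ge)
  · push Not at hsmall
    exact ⟨c, hc, hsmall⟩

end LipschitzRisk

section GaussianAverage

variable {E : Type*} [NormedAddCommGroup E] [InnerProductSpace ℝ E] [FiniteDimensional ℝ E]
  [MeasurableSpace E] {P : E → E} {u : E → ℝ} {Θ : Set E}

local notation "γ" => stdGaussian E

/-- The mean of `u (x + Z)` for a standard Gaussian vector `Z`. -/
noncomputable def gaussianAverage (u : E → ℝ) (x : E) : ℝ :=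
  ∫ z, u (x + z) ∂γ

/-- The excess of the Gaussian average of `u` over `½‖·‖²`. An approximate maximizer of it is
the centre of the least favourable prior. -/
noncomputable def gaussianExcess (u : E → ℝ) (x : E) : ℝ :=
  gaussianAverage u x - ‖x‖ ^ 2 / 2

variable [BorelSpace E]

lemma measurable_gaussianAverage (hu : Measurable u) : Measurable (gaussianAverage u) := by
  have huncurry : Measurable (Function.uncurry fun x z : E => u (x + z)) := by
    unfold Function.uncurry
    fun_prop
  exact huncurry.stronglyMeasurable.integral_prod_right.measurable

namespace IsNonexpansiveGradient

lemma integrable_comp_add (h : IsNonexpansiveGradient P u) (x : E) :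
    Integrable (fun z => u (x + z)) γ := by
  have hu := h.continuous
  have hinner := (integrable_inner_stdGaussian (P x)).abs
  have hsq : Integrable (fun z : E => ‖z‖ ^ 2) γ :=
    IsGaussian.memLp_two_id.integrable_norm_pow two_ne_zero
  refine (((integrable_const |u x|).add hinner).add hsq).mono' (by fun_prop)
    (ae_of_all _ fun z => ?_)
  have hlower := h.add_inner_le x (x + z)
  have hupper := h.le_add_inner_add_sq x (x + z)
  rw [add_sub_cancel_left, real_inner_comm] at hlower hupper
  rw [Real.norm_eq_abs, abs_le, Pi.add_apply, Pi.add_apply]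
  constructor
  · linarith [neg_abs_le (u x), neg_abs_le ⟪z, P x⟫, sq_nonneg ‖z‖]
  · linarith [le_abs_self (u x), le_abs_self ⟪z, P x⟫]

lemma bddAbove_range_gaussianExcess (h : IsNonexpansiveGradient P u) {M : ℝ}
    (hM : ∀ x, u x ≤ ‖x‖ ^ 2 / 2 + M) : BddAbove (Set.range (gaussianExcess u)) := by
  have hsq : Integrable (fun z : E => ‖z‖ ^ 2) γ :=
    IsGaussian.memLp_two_id.integrable_norm_pow two_ne_zero
  refine ⟨(∫ z : E, ‖z‖ ^ 2 ∂γ) / 2 + M, ?_⟩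
  rintro _ ⟨x, rfl⟩
  have hinner := integrable_inner_stdGaussian x
  have hmono : gaussianAverage u x ≤ ∫ z, (‖x‖ ^ 2 / 2 + M + ⟪z, x⟫ + ‖z‖ ^ 2 / 2) ∂γ := by
    refine integral_mono (h.integrable_comp_add x) (by fun_prop) fun z => ?_
    refine (hM _).trans_eq ?_
    rw [norm_add_sq_real, real_inner_comm]
    ring
  rw [integral_add (by fun_prop) (by fun_prop), integral_add (by fun_prop) hinner,
    integral_inner_stdGaussian, integral_div, integral_const, probReal_univ, one_smul] at hmono
  rw [gaussianExcess]
  linarith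

lemma gaussianAverage_add_inner_le (h : IsNonexpansiveGradient P u) (x y : E) :
    gaussianAverage u x + ⟪∫ z, P (x + z) ∂γ, y - x⟫ ≤ gaussianAverage u y := by
  have hP : Integrable (fun z => P (x + z)) γ := integrable_lipschitz_comp_add h.lipschitz x
  have hinner : Integrable (fun z => ⟪P (x + z), y - x⟫) γ := hP.inner_const _
  calc gaussianAverage u x + ⟪∫ z, P (x + z) ∂γ, y - x⟫
      = ∫ z, (u (x + z) + ⟪P (x + z), y - x⟫) ∂γ := by
        rw [integral_add (h.integrable_comp_add x) hinner, gaussianAverage]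
        simp_rw [real_inner_comm (y - x)]
        rw [integral_inner hP]
    _ ≤ gaussianAverage u y := by
        refine integral_mono ((h.integrable_comp_add x).add hinner) (h.integrable_comp_add y)
          fun z => ?_
        simpa using h.add_inner_le (x + z) (y + z)

lemma gaussianExcess_le_gaussianExcess_integral (h : IsNonexpansiveGradient P u) (x : E) :
    gaussianExcess u x ≤ gaussianExcess u (∫ z, P (x + z) ∂γ) := by
  set θ := ∫ z, P (x + z) ∂γ
  have havg : gaussianAverage u x + ⟪θ, θ - x⟫ ≤ gaussianAverage u θ :=
    h.gaussianAverage_add_inner_le x θ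
  have hsq : 0 ≤ ‖θ - x‖ ^ 2 := sq_nonneg _
  rw [norm_sub_sq_real] at hsq
  rw [inner_sub_right, real_inner_self_eq_norm_sq] at havg
  rw [gaussianExcess, gaussianExcess]
  linarith

lemma exists_forall_gaussianExcess_le (h : IsNonexpansiveGradient P u) (hΘc : IsClosed Θ)
    (hΘ : Convex ℝ Θ) (hPΘ : ∀ x, P x ∈ Θ) (hbdd : BddAbove (Set.range (gaussianExcess u)))
    {η : ℝ} (hη : 0 < η) : ∃ θ ∈ Θ, ∀ x, gaussianExcess u x ≤ gaussianExcess u θ + η := by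
  obtain ⟨x₀, hx₀⟩ := exists_lt_of_lt_ciSup (sub_lt_self (⨆ x, gaussianExcess u x) hη)
  refine ⟨∫ z, P (x₀ + z) ∂γ, hΘ.integral_mem hΘc (ae_of_all _ fun z => hPΘ _)
    (integrable_lipschitz_comp_add h.lipschitz x₀), fun x => ?_⟩
  linarith [le_ciSup hbdd x, h.gaussianExcess_le_gaussianExcess_integral x₀]

end IsNonexpansiveGradient

end GaussianAverage

section BayesBound

variable {E : Type*} [NormedAddCommGroup E] [InnerProductSpace ℝ E] [FiniteDimensional ℝ E]
  [MeasurableSpace E] {P D m : E → E} {u : E → ℝ} {θ : E} {η l : ℝ}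

local notation "γ" => stdGaussian E

/-- The part of the exponent in the Bayes bound that depends only on the seed `z` of the parameter
`θ + m z`; the rest also involves the noise `w` of the observation `θ + m z + w`. -/
noncomputable def bayesExponent (P : E → E) (u : E → ℝ) (θ : E) (l : ℝ) (z : E) : ℝ :=
  l * (u (θ + z) - gaussianAverage u θ - ⟪z, θ⟫ + ‖P (θ + z) - θ‖ ^ 2 / 2)
    - 8 * l ^ 2 * ‖P (θ + z) - θ‖ ^ 2

namespace IsNonexpansiveGradient

lemma sub_gaussianAverage_add_le (h : IsNonexpansiveGradient P u)
    (hθ : ∀ x, gaussianExcess u x ≤ gaussianExcess u θ + η) (d z : E) :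
    u (θ + z) - gaussianAverage u θ + ‖P (θ + z) - θ‖ ^ 2 / 2 - ‖d - P (θ + z)‖ ^ 2 / 2 - η ≤
      u (d + z) - gaussianAverage u d := by
  have hsub : u (θ + z) + ⟪P (θ + z), d - θ⟫ ≤ u (d + z) := by
    simpa using h.add_inner_le (θ + z) (d + z)
  have hexcess := hθ d
  rw [gaussianExcess, gaussianExcess] at hexcess
  have hpolar : ‖P (θ + z) - θ‖ ^ 2 / 2 - ‖d - P (θ + z)‖ ^ 2 / 2 =
      ⟪P (θ + z), d - θ⟫ + ‖θ‖ ^ 2 / 2 - ‖d‖ ^ 2 / 2 := by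
    rw [norm_sub_sq_real, norm_sub_sq_real, inner_sub_right, real_inner_comm d]
    ring
  linarith

lemma bayesExponent_sub_le (h : IsNonexpansiveGradient P u)
    (hθ : ∀ x, gaussianExcess u x ≤ gaussianExcess u θ + η) (hl : 0 ≤ l) (d z : E) :
    bayesExponent P u θ l z - l * η - (l / 2 + 2 * l ^ 2) * ‖d - P (θ + z)‖ ^ 2 ≤
      l * (u (d + z) - ⟪z, θ⟫) - l ^ 2 * ‖P (d + z) - θ‖ ^ 2 - l * gaussianAverage u d := by
  have hdrift := mul_le_mul_of_nonneg_left (h.sub_gaussianAverage_add_le hθ d z) hl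
  have hnorm := mul_le_mul_of_nonneg_left (norm_comp_add_sub_sq_le_add h.lipschitz θ d z)
    (sq_nonneg l)
  rw [bayesExponent]
  linarith

variable [BorelSpace E]

lemma lintegral_exp_sub_le_one (h : IsNonexpansiveGradient P u) (θ d : E) (hl : 0 ≤ l) :
    ∫⁻ z, ENNReal.ofReal (Real.exp (l * (u (d + z) - ⟪z, θ⟫) - l ^ 2 * ‖P (d + z) - θ‖ ^ 2
      - l * gaussianAverage u d)) ∂γ ≤ 1 := by
  have hu := h.continuous
  have hP := h.lipschitz.continuous
  have hint := h.integrable_comp_add d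
  have hinner := integrable_inner_stdGaussian θ
  have hmean : ∫ z, (u (d + z) - ⟪z, θ⟫) ∂γ = gaussianAverage u d := by
    rw [integral_sub hint hinner, integral_inner_stdGaussian, sub_zero, gaussianAverage]
  have hsub (z y : E) :
      u (d + z) - ⟪z, θ⟫ + ⟪P (d + z) - θ, y - z⟫ ≤ u (d + y) - ⟪y, θ⟫ := by
    have hle := h.add_inner_le (d + z) (d + y)
    rw [add_sub_add_left_eq_sub] at hle
    rw [inner_sub_left, inner_sub_right θ, real_inner_comm y, real_inner_comm z]
    linarith
  rw [← hmean]
  exact (propertyTau_stdGaussian E).lintegral_exp_le_one (g := fun z => P (d + z) - θ)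
    (by fun_prop) (by fun_prop) (hint.sub hinner) hsub hl

lemma lintegral_prod_exp_sub_le_one (h : IsNonexpansiveGradient P u) (θ : E) (hD : Measurable D)
    (hm : Measurable m) (hl : 0 ≤ l) :
    ∫⁻ ω, ENNReal.ofReal (Real.exp (-⟪ω.2, m ω.1⟫ - ‖m ω.1‖ ^ 2 / 2)) *
      ENNReal.ofReal (Real.exp (l * (u (D (ω.2 + m ω.1) + ω.1) - ⟪ω.1, θ⟫)
        - l ^ 2 * ‖P (D (ω.2 + m ω.1) + ω.1) - θ‖ ^ 2
        - l * gaussianAverage u (D (ω.2 + m ω.1)))) ∂Measure.prod γ γ ≤ 1 := by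
  have hu := h.continuous.measurable
  have hP := h.lipschitz.continuous.measurable
  have havg := measurable_gaussianAverage hu
  rw [lintegral_prod_exp_mul_comp_add_stdGaussian hm
    (F := fun ω => ENNReal.ofReal (Real.exp (l * (u (D ω.2 + ω.1) - ⟪ω.1, θ⟫)
      - l ^ 2 * ‖P (D ω.2 + ω.1) - θ‖ ^ 2 - l * gaussianAverage u (D ω.2)))) (by fun_prop),
    lintegral_prod_symm' _ (by fun_prop)]
  calc _ ≤ ∫⁻ _, 1 ∂γ := lintegral_mono fun x => h.lintegral_exp_sub_le_one θ (D x) hl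
    _ = 1 := by simp

lemma lintegral_exp_bayesExponent_le_one (h : IsNonexpansiveGradient P u)
    (hθ : ∀ x, gaussianExcess u x ≤ gaussianExcess u θ + η) (hD : Measurable D)
    (hm : Measurable m) (hl : 0 ≤ l) :
    ∫⁻ ω, ENNReal.ofReal (Real.exp (bayesExponent P u θ l ω.1 - l * η
      - (l / 2 + 2 * l ^ 2) * ‖D (ω.2 + m ω.1) - P (θ + ω.1)‖ ^ 2
      - ‖m ω.1‖ ^ 2 / 2 - ⟪ω.2, m ω.1⟫)) ∂Measure.prod γ γ ≤ 1 := by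
  refine le_trans (lintegral_mono fun ω => ?_) (h.lintegral_prod_exp_sub_le_one θ hD hm hl)
  rw [← ENNReal.ofReal_mul (Real.exp_pos _).le, ← Real.exp_add]
  refine ENNReal.ofReal_le_ofReal (Real.exp_le_exp.2 ?_)
  linarith [h.bayesExponent_sub_le hθ hl (D (ω.2 + m ω.1)) ω.1]

lemma integrable_sub_gaussianAverage_sub_inner (h : IsNonexpansiveGradient P u) (θ : E) :
    Integrable (fun z => u (θ + z) - gaussianAverage u θ - ⟪z, θ⟫) γ :=
  ((h.integrable_comp_add θ).sub (integrable_const _)).sub (integrable_inner_stdGaussian θ)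

lemma integral_sub_gaussianAverage_sub_inner (h : IsNonexpansiveGradient P u) (θ : E) :
    ∫ z, (u (θ + z) - gaussianAverage u θ - ⟪z, θ⟫) ∂γ = 0 := by
  have hint := h.integrable_comp_add θ
  rw [integral_sub (hint.sub' (integrable_const _)) (integrable_inner_stdGaussian θ),
    integral_sub hint (integrable_const _), integral_inner_stdGaussian, gaussianAverage]
  simp

lemma integrable_bayesExponent (h : IsNonexpansiveGradient P u) (θ : E) (l : ℝ) :
    Integrable (bayesExponent P u θ l) γ :=
  have hP := integrable_norm_comp_add_sub_sq h.lipschitz θ θ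
  (((h.integrable_sub_gaussianAverage_sub_inner θ).add (hP.div_const 2)).const_mul l).sub
    (hP.const_mul _)

lemma integral_bayesExponent (h : IsNonexpansiveGradient P u) (θ : E) (l : ℝ) :
    ∫ z, bayesExponent P u θ l z ∂γ = l * (realRisk P θ / 2) - 8 * l ^ 2 * realRisk P θ := by
  have hlin := h.integrable_sub_gaussianAverage_sub_inner θ
  have hP := integrable_norm_comp_add_sub_sq h.lipschitz θ θ
  simp only [bayesExponent]
  rw [integral_sub ((hlin.fun_add (hP.div_const 2)).const_mul l) (hP.const_mul _),
    integral_const_mul, integral_const_mul, integral_add hlin (hP.div_const 2),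
    h.integral_sub_gaussianAverage_sub_inner, zero_add, integral_div, realRisk]

end IsNonexpansiveGradient

variable [BorelSpace E]

lemma integrable_prod_inner_stdGaussian (hm : Integrable m γ) :
    Integrable (fun ω : E × E => ⟪ω.2, m ω.1⟫) (Measure.prod γ γ) :=
  hm.op_fst_snd (op := fun x y => ⟪y, x⟫) (by fun_prop)
    ⟨1, fun x y => by simpa [mul_comm] using abs_real_inner_le_norm y x⟩
    (IsGaussian.memLp_two_id.integrable one_le_two)

lemma integral_prod_inner_stdGaussian (hm : Integrable m γ) :
    ∫ ω : E × E, ⟪ω.2, m ω.1⟫ ∂Measure.prod γ γ = 0 := by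
  rw [integral_prod _ (integrable_prod_inner_stdGaussian hm)]
  simp [integral_inner_stdGaussian]

lemma IsNonexpansiveGradient.bayes_bound (h : IsNonexpansiveGradient P u)
    (hθ : ∀ x, gaussianExcess u x ≤ gaussianExcess u θ + η) (hD : Measurable D)
    (hm : Measurable m) (hm₂ : MemLp m 2 γ) (hl : 0 ≤ l)
    (herr : Integrable (fun ω : E × E => ‖D (ω.2 + m ω.1) - P (θ + ω.1)‖ ^ 2) (Measure.prod γ γ)) :
    l * (realRisk P θ / 2 - η) - 8 * l ^ 2 * realRisk P θ ≤
      (∫ z, ‖m z‖ ^ 2 ∂γ) / 2 +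
        (l / 2 + 2 * l ^ 2) * ∫ ω, ‖D (ω.2 + m ω.1) - P (θ + ω.1)‖ ^ 2 ∂Measure.prod γ γ := by
  have hexponent := (h.integrable_bayesExponent θ l).comp_fst γ
  have hnorm : Integrable (fun ω : E × E => ‖m ω.1‖ ^ 2) (Measure.prod γ γ) :=
    (hm₂.integrable_norm_pow two_ne_zero).comp_fst γ
  have hcross := integrable_prod_inner_stdGaussian (hm₂.integrable one_le_two)
  have hmean := integral_nonpos_of_lintegral_exp_le_one (by fun_prop)
    (h.lintegral_exp_bayesExponent_le_one hθ hD hm hl)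
  rw [integral_sub (by fun_prop) hcross, integral_sub (by fun_prop) (by fun_prop),
    integral_sub (by fun_prop) (by fun_prop), integral_sub hexponent (by fun_prop),
    integral_prod_inner_stdGaussian (hm₂.integrable one_le_two), integral_div,
    integral_const_mul (l / 2 + 2 * l ^ 2), integral_fun_fst (bayesExponent P u θ l),
    integral_fun_fst fun z => ‖m z‖ ^ 2, h.integral_bayesExponent, integral_const] at hmean
  simp only [probReal_univ, one_smul] at hmean
  linarith

end BayesBound

section InducedEstimator

variable {E : Type*} [NormedAddCommGroup E] [InnerProductSpace ℝ E] {δ' : E → E} {s : ℝ}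

/-- The estimator of `P (θ + z)` that `δ'` induces when the parameter is
`θ + s • (P (θ + z) - θ)`, as a function of the observation minus `θ`. -/
noncomputable def inducedEstimator (δ' : E → E) (θ : E) (s : ℝ) (x : E) : E :=
  θ + s⁻¹ • (δ' (θ + x) - θ)

lemma inducedEstimator_add_smul_sub (δ' : E → E) (hs : s ≠ 0) (θ p x : E) :
    inducedEstimator δ' θ s (x + s • (p - θ)) - p =
      s⁻¹ • (δ' (θ + s • (p - θ) + x) - (θ + s • (p - θ))) := by
  rw [inducedEstimator, add_comm x, ← add_assoc, ← sub_sub _ θ, smul_sub s⁻¹ (_ - θ),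
    inv_smul_smul₀ hs]
  abel

lemma measurable_inducedEstimator [FiniteDimensional ℝ E] [MeasurableSpace E]
    [BorelSpace E] (hδ' : Measurable δ') (θ : E) (s : ℝ) :
    Measurable (inducedEstimator δ' θ s) := by
  unfold inducedEstimator
  fun_prop

end InducedEstimator

section Admissibility

variable {E : Type*} [NormedAddCommGroup E] [InnerProductSpace ℝ E] [FiniteDimensional ℝ E]
  [MeasurableSpace E] [BorelSpace E] {P δ' : E → E} {u : E → ℝ} {θ : E} {Θ : Set E} {s : ℝ}

local notation "γ" => stdGaussian E

lemma lintegral_gaussianRisk_add_smul_le (hP : LipschitzWith 1 P) (θ : E) (s : ℝ) :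
    ∫⁻ z, gaussianRisk P (θ + s • (P (θ + z) - θ)) ∂γ ≤
      ENNReal.ofReal ((2 + 8 * s ^ 2) * realRisk P θ) := by
  have hint := integrable_norm_comp_add_sub_sq hP θ θ
  have hbound (z : E) : gaussianRisk P (θ + s • (P (θ + z) - θ)) ≤
      ENNReal.ofReal (2 * realRisk P θ + 8 * s ^ 2 * ‖P (θ + z) - θ‖ ^ 2) := by
    rw [gaussianRisk_eq_ofReal_realRisk hP]
    refine ENNReal.ofReal_le_ofReal ((realRisk_le hP θ _).trans_eq ?_)
    rw [add_sub_cancel_left, norm_smul, mul_pow, Real.norm_eq_abs, sq_abs]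
    ring
  refine (lintegral_mono hbound).trans_eq ?_
  have hR := realRisk_nonneg P θ
  rw [← ofReal_integral_eq_lintegral_ofReal (by fun_prop) (ae_of_all _ fun z => by positivity),
    integral_add (by fun_prop) (by fun_prop), integral_const, integral_const_mul, probReal_univ,
    one_smul, ← realRisk]
  congr 1
  ring

lemma lintegral_norm_inducedEstimator_sub_sq (hP : Measurable P) (hδ' : Measurable δ')
    (hs : s ≠ 0) (θ : E) :
    ∫⁻ ω, ENNReal.ofReal (‖inducedEstimator δ' θ s (ω.2 + s • (P (θ + ω.1) - θ))
        - P (θ + ω.1)‖ ^ 2) ∂Measure.prod γ γ =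
      ENNReal.ofReal (s⁻¹ ^ 2) * ∫⁻ z, gaussianRisk δ' (θ + s • (P (θ + z) - θ)) ∂γ := by
  simp_rw [inducedEstimator_add_smul_sub δ' hs, norm_smul, mul_pow, Real.norm_eq_abs, sq_abs,
    ENNReal.ofReal_mul (sq_nonneg s⁻¹)]
  rw [lintegral_const_mul _ (by fun_prop), lintegral_prod _ (by fun_prop)]
  rfl

namespace IsNonexpansiveGradient

lemma ofReal_lt_lintegral_norm_inducedEstimator_sub_sq (h : IsNonexpansiveGradient P u)
    (hR : 0 < realRisk P θ)
    (hθ : ∀ x, gaussianExcess u x ≤ gaussianExcess u θ + realRisk P θ / 100)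
    (hδ' : Measurable δ') :
    ENNReal.ofReal (3 / 10 * realRisk P θ) <
      ∫⁻ ω, ENNReal.ofReal (‖inducedEstimator δ' θ (1 / 16)
        (ω.2 + (1 / 16 : ℝ) • (P (θ + ω.1) - θ)) - P (θ + ω.1)‖ ^ 2) ∂Measure.prod γ γ := by
  by_contra! hle
  have hP := h.lipschitz.continuous.measurable
  have hD := measurable_inducedEstimator hδ' θ (1 / 16)
  have hm : MemLp (fun z => (1 / 16 : ℝ) • (P (θ + z) - θ)) 2 γ :=
    (memLp_two_comp_add_sub h.lipschitz θ θ).const_smul _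
  have hm_sq : ∫ z, ‖(1 / 16 : ℝ) • (P (θ + z) - θ)‖ ^ 2 ∂γ = 1 / 256 * realRisk P θ := by
    simp_rw [norm_smul, mul_pow]
    rw [integral_const_mul, realRisk]
    norm_num
  have herr_nonneg : 0 ≤ᵐ[Measure.prod γ γ] fun ω : E × E => ‖inducedEstimator δ' θ (1 / 16)
      (ω.2 + (1 / 16 : ℝ) • (P (θ + ω.1) - θ)) - P (θ + ω.1)‖ ^ 2 :=
    ae_of_all _ fun _ => sq_nonneg _
  have herr := (lintegral_ofReal_ne_top_iff_integrable (by fun_prop) herr_nonneg).1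
    (ne_top_of_le_ne_top ENNReal.ofReal_ne_top hle)
  rw [← ofReal_integral_eq_lintegral_ofReal herr herr_nonneg,
    ENNReal.ofReal_le_ofReal_iff (by positivity)] at hle
  have hbayes := h.bayes_bound hθ hD (by fun_prop) hm (show (0 : ℝ) ≤ 1 / 64 by norm_num) herr
  rw [hm_sq] at hbayes
  linarith

theorem exists_mem_mul_gaussianRisk_lt (h : IsNonexpansiveGradient P u) (hΘc : IsClosed Θ)
    (hΘ : Convex ℝ Θ) (hPΘ : ∀ x, P x ∈ Θ) (hbdd : BddAbove (Set.range (gaussianExcess u)))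
    (hpos : ∀ θ ∈ Θ, 0 < realRisk P θ) (hδ' : Measurable δ') :
    ∃ θ ∈ Θ, ENNReal.ofReal (1 / 2000) * gaussianRisk P θ < gaussianRisk δ' θ := by
  by_contra! hle
  obtain ⟨r, hr, hrR⟩ := exists_pos_le_realRisk h.lipschitz hΘc hpos
  obtain ⟨θ, hθ, hmax⟩ := h.exists_forall_gaussianExcess_le hΘc hΘ hPΘ hbdd
    (show 0 < r / 100 by positivity)
  have hprior (z : E) : θ + (1 / 16 : ℝ) • (P (θ + z) - θ) ∈ Θ :=
    hΘ.add_smul_sub_mem hθ (hPΘ _) ⟨by norm_num, by norm_num⟩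
  have hlower := h.ofReal_lt_lintegral_norm_inducedEstimator_sub_sq (hpos θ hθ)
    (fun x => (hmax x).trans (by linarith [hrR θ hθ])) hδ'
  rw [lintegral_norm_inducedEstimator_sub_sq h.lipschitz.continuous.measurable hδ'
    (by norm_num)] at hlower
  refine hlower.not_ge ?_
  calc ENNReal.ofReal ((1 / 16)⁻¹ ^ 2) *
        ∫⁻ z, gaussianRisk δ' (θ + (1 / 16 : ℝ) • (P (θ + z) - θ)) ∂γ
      ≤ ENNReal.ofReal ((1 / 16)⁻¹ ^ 2) * ∫⁻ z, ENNReal.ofReal (1 / 2000) *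
          gaussianRisk P (θ + (1 / 16 : ℝ) • (P (θ + z) - θ)) ∂γ := by
        gcongr with z
        exact hle _ (hprior z)
    _ ≤ ENNReal.ofReal ((1 / 16)⁻¹ ^ 2) * (ENNReal.ofReal (1 / 2000) *
          ENNReal.ofReal ((2 + 8 * (1 / 16) ^ 2) * realRisk P θ)) := by
        rw [lintegral_const_mul' _ _ ENNReal.ofReal_ne_top]
        gcongr
        exact lintegral_gaussianRisk_add_smul_le h.lipschitz θ _
    _ ≤ ENNReal.ofReal (3 / 10 * realRisk P θ) := by
        rw [← ENNReal.ofReal_mul (by norm_num), ← ENNReal.ofReal_mul (by norm_num)]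
        exact ENNReal.ofReal_le_ofReal (by linarith [hpos θ hθ])

end IsNonexpansiveGradient

end Admissibility

section Closure

variable {E : Type*} [NormedAddCommGroup E] [InnerProductSpace ℝ E] [FiniteDimensional ℝ E]
  [MeasurableSpace E] [BorelSpace E] {P δ' : E → E} {u : E → ℝ} {θ : E} {Θ : Set E}

local notation "γ" => stdGaussian E

lemma mem_of_realRisk_eq_zero (hP : LipschitzWith 1 P) (hPΘ : ∀ᵐ x, P x ∈ Θ)
    (hθ : realRisk P θ = 0) : θ ∈ Θ := by
  have hshift : ∀ᵐ z ∂γ, P (θ + z) ∈ Θ := stdGaussian_absolutelyContinuous.ae_le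
    ((measurePreserving_add_left volume θ).quasiMeasurePreserving.ae hPΘ)
  have hconst : ∀ᵐ z ∂γ, ‖P (θ + z) - θ‖ ^ 2 = 0 :=
    (integral_eq_zero_iff_of_nonneg (fun _ => sq_nonneg _)
      (integrable_norm_comp_add_sub_sq hP θ θ)).1 hθ
  obtain ⟨z, hz, hzθ⟩ := (hshift.and hconst).exists
  rwa [← sub_eq_zero.1 (norm_eq_zero.1 (pow_eq_zero_iff two_ne_zero |>.1 hzθ))]

lemma gaussianRisk_le_mul_of_mem_closure (hP : LipschitzWith 1 P) (hδ' : Measurable δ') {C : ℝ}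
    (hle : ∀ θ ∈ Θ, gaussianRisk δ' θ ≤ ENNReal.ofReal C * gaussianRisk P θ)
    (hθ : θ ∈ closure Θ) : gaussianRisk δ' θ ≤ ENNReal.ofReal C * gaussianRisk P θ := by
  have hcont : Continuous fun θ => ENNReal.ofReal C * gaussianRisk P θ := by
    simp_rw [gaussianRisk_eq_ofReal_realRisk hP]
    exact (ENNReal.continuous_const_mul ENNReal.ofReal_ne_top).comp
      (ENNReal.continuous_ofReal.comp (continuous_realRisk hP))
  have hclosed : IsClosed {θ | gaussianRisk δ' θ ≤ ENNReal.ofReal C * gaussianRisk P θ} :=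
    (lowerSemicontinuous_gaussianRisk hδ').isClosed_epigraph.preimage (continuous_id.prodMk hcont)
  exact closure_minimal hle hclosed hθ

theorem IsNonexpansiveGradient.exists_mem_mul_gaussianRisk_le (h : IsNonexpansiveGradient P u)
    (hΘ : Convex ℝ Θ) (hPΘ : ∀ᵐ x, P x ∈ Θ) (hbdd : BddAbove (Set.range (gaussianExcess u)))
    (hδ' : Measurable δ') :
    ∃ θ ∈ Θ, ENNReal.ofReal (1 / 2000) * gaussianRisk P θ ≤ gaussianRisk δ' θ := by
  by_contra! hlt
  have hPclosure (x : E) : P x ∈ closure Θ :=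
    (Measure.dense_of_ae hPΘ).induction (fun _ hx => subset_closure hx)
      (isClosed_closure.preimage h.lipschitz.continuous) x
  have hpos (θ : E) : 0 < realRisk P θ := by
    refine (realRisk_nonneg P θ).lt_of_ne' fun hzero => ?_
    have hθ := hlt θ (mem_of_realRisk_eq_zero h.lipschitz hPΘ hzero)
    simp [gaussianRisk_eq_ofReal_realRisk h.lipschitz, hzero] at hθ
  obtain ⟨θ, hθ, hθ_lt⟩ := h.exists_mem_mul_gaussianRisk_lt isClosed_closure hΘ.closure
    hPclosure hbdd (fun θ _ => hpos θ) hδ'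
  exact hθ_lt.not_ge (gaussianRisk_le_mul_of_mem_closure h.lipschitz hδ'
    (fun θ hθ => (hlt θ hθ).le) hθ)

end Closure

end GaussianSequence

theorem theorem2_general {E : Type*} [NormedAddCommGroup E] [InnerProductSpace ℝ E]
    [FiniteDimensional ℝ E] [MeasurableSpace E] [BorelSpace E] {Θ : Set E} {f : E → ℝ}
    {δ δ' : E → E} (hf : ConvexOn ℝ Θ f) (hfb : BddBelow (f '' Θ))
    (hδ : ∀ᵐ x, GaussianSequence.IsProxPoint Θ f x (δ x)) (hδ' : Measurable δ') :
    ∃ θ ∈ Θ, ENNReal.ofReal (1 / 2000) * GaussianSequence.gaussianRisk δ θ ≤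
      GaussianSequence.gaussianRisk δ' θ := by
  obtain ⟨P, hP, hδP⟩ := GaussianSequence.exists_isNonexpansiveGradient_proxPotential hf hfb hδ
  have hPΘ : ∀ᵐ x, P x ∈ Θ := by
    filter_upwards [hδ, hδP] with x hx hxP using hxP ▸ hx.1
  have hne : Θ.Nonempty := have ⟨x, hx⟩ := hδ.exists; ⟨δ x, hx.1⟩
  obtain ⟨M, hM⟩ := GaussianSequence.exists_forall_proxPotential_le hne hfb
  simp_rw [GaussianSequence.gaussianRisk_congr hδP]
  exact hP.exists_mem_mul_gaussianRisk_le hf.1 hPΘ (hP.bddAbove_range_gaussianExcess hM) hδ'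

theorem theorem2 :
    ∃ C : ℝ, 0 < C ∧ C ≤ 1 ∧ (6.05e-6 : ℝ) ≤ C ∧
      ∀ n : ℕ, 1 ≤ n →
      ∀ Θ : Set (EuclideanSpace ℝ (Fin n)), IsClosed Θ → Convex ℝ Θ →
      ∀ f : EuclideanSpace ℝ (Fin n) → ℝ, ConvexOn ℝ Θ f → BddBelow (f '' Θ) →
      ∀ δ : EuclideanSpace ℝ (Fin n) → EuclideanSpace ℝ (Fin n),
        GaussianSequence.IsPenalizedLSE Θ f δ →
        GaussianSequence.IsCAdmissible C Θ δ := by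
  refine ⟨1 / 2000, by norm_num, by norm_num, by norm_num, fun n _ Θ _ _ f hf hfb δ hδ δ' hδ' => ?_⟩
  simpa only [GaussianSequence.risk_eq_gaussianRisk] using theorem2_general hf hfb hδ hδ'
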